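/- Let $d\ge 1$. For $z=(x,\xi)\in\mathbb{R}^{2d}$ and $f\in L^2(\mathbb{R}^d)$ let $\pi(z)f(t)=e^{2\pi i\xi\cdot t}f(t-x)$ be the time-frequency shift. Let $s>2d$ and let $g\in M^\infty_{v_s}(\mathbb{R}^d)$, which means that $g\in L^2(\mathbb{R}^d)$ and that there is a constant $C$ with $$|V_gg(z)|\le C(1+|z|)^{-s}\quad\text{for all } z\in\mathbb{R}^{2d},\qquad\text{where } V_gg(x,\xi)=\int_{\mathbb{R}^d}g(t)\,\overline{g(t-x)}\,e^{-2\pi i\xi\cdot t}\,dt .$$ Let $\Lambda\subseteq\mathbb{R}^{2d}$ be a lattice, i.e. $\Lambda=M\mathbb{Z}^{2d}$ for an invertible real $2d\times 2d$ matrix $M$, and suppose that $\mathcal{G}(g,\Lambda)=\{\pi(\lambda)g:\lambda\in\Lambda\}$ is a frame for $L^2(\mathbb{R}^d)$, i.e. there are constants $A,B>0$ with $$A\|f\|_2^2\le\sum_{\lambda\in\Lambda}|\langle f,\pi(\lambda)g\rangle|^2\le B\|f\|_2^2\quad\text{for all } f\in L^2(\mathbb{R}^d).$$ Then there is $\varepsilon_0>0$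 such that $\mathcal{G}(g,(1+\tau)\Lambda)$ is a frame for $L^2(\mathbb{R}^d)$ for every real $\tau$ with $|\tau|<\varepsilon_0$. -/

import Mathlib

open MeasureTheory
open scoped Pointwise ENNReal ComplexConjugate

noncomputable section

namespace Gabor

/-- Configuration space `ℝ^d` with the Euclidean norm. -/
abbrev Rd (d : ℕ) := EuclideanSpace ℝ (Fin d)

/-- Phase space `ℝ^{2d}` with the Euclidean norm; a point is `z = (x, ξ)`, the coordinates of `x`
being indexed by the left summand and those of `ξ` by the right one. -/
abbrev Phase (d : ℕ) := EuclideanSpace ℝ (Fin d ⊕ Fin d)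

/-- The Hilbert space `L²(ℝ^d)` of complex-valued functions, for Lebesgue measure. -/
abbrev L2 (d : ℕ) := Lp ℂ 2 (volume : Measure (Rd d))

/-- The time component `x` of `z = (x, ξ)`. -/
def timePart {d : ℕ} (z : Phase d) : Rd d := WithLp.toLp 2 fun i => z (Sum.inl i)

/-- The frequency component `ξ` of `z = (x, ξ)`. -/
def freqPart {d : ℕ} (z : Phase d) : Rd d := WithLp.toLp 2 fun i => z (Sum.inr i)

/-- The time-frequency shift of a function: `(π(x, ξ) f)(t) = e^{2πi ξ·t} f(t - x)`. -/
def tfShiftFun {d : ℕ} (z : Phase d) (f : Rd d → ℂ) (t : Rd d) : ℂ :=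
  Complex.exp (2 * Real.pi * Complex.I * (inner ℝ (freqPart z) t : ℝ)) * f (t - timePart z)

theorem memLp_tfShiftFun {d : ℕ} (z : Phase d) {f : Rd d → ℂ} (hf : MemLp f 2 volume) :
    MemLp (tfShiftFun z f) 2 volume := by
  have h1 : MemLp (fun t => f (t - timePart z)) 2 volume :=
    hf.comp_measurePreserving (measurePreserving_sub_right volume (timePart z))
  have hc : Continuous fun t : Rd d =>
      Complex.exp (2 * Real.pi * Complex.I * (inner ℝ (freqPart z) t : ℝ)) := by fun_prop
  refine h1.congr_norm (hc.aestronglyMeasurable.mul h1.aestronglyMeasurable) ?_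
  refine Filter.Eventually.of_forall fun t => ?_
  have : ‖Complex.exp (2 * Real.pi * Complex.I * (inner ℝ (freqPart z) t : ℝ))‖ = 1 := by
    rw [Complex.norm_exp]
    simp
  simp only [tfShiftFun, norm_mul, this, one_mul]

/-- The time-frequency shift `π(z)` on `L²(ℝ^d)`. -/
def tfShift {d : ℕ} (z : Phase d) (f : L2 d) : L2 d :=
  (memLp_tfShiftFun z (Lp.memLp f)).toLp (tfShiftFun z f)

/-- The short-time Fourier transform
`V_g f (x, ξ) = ∫ f(t) conj(g(t - x)) e^{-2πi ξ·t} dt`. -/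
def stft {d : ℕ} (g f : L2 d) (z : Phase d) : ℂ :=
  ∫ t : Rd d, f t * conj (g (t - timePart z)) *
    Complex.exp (-(2 * Real.pi * Complex.I * (inner ℝ (freqPart z) t : ℝ)))

/-- The class `M^∞_{v_s}(ℝ^d)`: those `g ∈ L²(ℝ^d)` for which there is a constant `C` with
`|V_g g(z)| ≤ C (1 + |z|)^{-s}` for all `z`. -/
def MemModulation {d : ℕ} (s : ℝ) (g : L2 d) : Prop :=
  ∃ C : ℝ, ∀ z : Phase d, ‖stft g g z‖ ≤ C * (1 + ‖z‖) ^ (-s)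

/-- A family of vectors in a Hilbert space is a frame if there are `A, B > 0` with
`A ‖f‖² ≤ ∑ᵢ |⟨f, φᵢ⟩|² ≤ B ‖f‖²` for all `f`, the series being convergent. -/
def IsFrame {ι H : Type*} [NormedAddCommGroup H] [InnerProductSpace ℂ H] (φ : ι → H) : Prop :=
  ∃ A B : ℝ, 0 < A ∧ 0 < B ∧ ∀ f : H,
    Summable (fun i => ‖inner ℂ (φ i) f‖ ^ 2) ∧
    A * ‖f‖ ^ 2 ≤ ∑' i, ‖inner ℂ (φ i) f‖ ^ 2 ∧
    ∑' i, ‖inner ℂ (φ i) f‖ ^ 2 ≤ B * ‖f‖ ^ 2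

/-- The Gabor system `G(g, Λ) = (π(λ) g)_{λ ∈ Λ}`. -/
def gaborSystem {d : ℕ} (g : L2 d) (Λ : Set (Phase d)) : Λ → L2 d :=
  fun l => tfShift (l : Phase d) g

/-- A lattice in phase space: `Λ = M ℤ^{2d}` for an invertible real `2d × 2d` matrix `M`. -/
def IsLattice {d : ℕ} (Λ : Set (Phase d)) : Prop :=
  ∃ M : Matrix (Fin d ⊕ Fin d) (Fin d ⊕ Fin d) ℝ, M.det ≠ 0 ∧
    Λ = Set.range fun k : Fin d ⊕ Fin d → ℤ =>
      (WithLp.toLp 2 (M.mulVec fun i => (k i : ℝ)) : Phase d)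

end Gabor

end

noncomputable section

namespace Gabor

open scoped NNReal

/-! ### Schur's test -/

/-! Write the lattice as the image of the integer points under a matrix, and put `e y = π(My)g`. A
dilation moves distant lattice points arbitrarily far, so a global perturbation argument is not
available. Locally, however, it is almost a translation: for `m` near `R j`, the point `(1+τ)m`
differs from `m + τ R j` by only `τ(m - R j)`. Translated lattices give frames with the same bounds,
since time-frequency shifts act isometrically up to phases (`IsCovariant`).

To use this, expand `f` in the original frame with square-summable coefficients `c`
(`exists_expansion`) and multiply `c` by tents of width `T = (1+τ)R` centred at `T j`. The frame
coefficients of these local parts are nearly tent multiples of those of `f`. The error is a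
commutator of a tent with the Gram kernel. Polynomial decay of order greater than the dimension and
Schur's test make it small in `ℓ²` for large `T`, uniformly over the sampling sets
(`exists_localError_le`).

For each local part, apply the lower bound of the translated frame and replace translated samples by
dilated ones in a bounded window (`lower_bound_localPart`). Summing over `j` and absorbing the
errors gives the lower bound; the upper bound is a Bessel estimate (`exists_bessel_bound`). The
scale `R` is fixed before the size of `τ`, so the window contains a bounded number of points, each
moved by little. -/

theorem sq_tsum_mul_le {β : Type*} (K c : β → ℝ≥0∞) :
    (∑' y, K y * c y) ^ 2 ≤ (∑' y, K y) * ∑' y, K y * c y ^ 2 := by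
  let _ : MeasurableSpace β := ⊤
  have h := ENNReal.lintegral_mul_le_Lp_mul_Lq (Measure.count : Measure β)
    Real.HolderConjugate.two_two (f := fun y => K y ^ (1 / 2 : ℝ))
    (g := fun y => K y ^ (1 / 2 : ℝ) * c y) measurable_from_top.aemeasurable
    measurable_from_top.aemeasurable
  have e1 : ∀ y, (K y ^ (1 / 2 : ℝ)) ^ (2 : ℝ) = K y := fun y => by
    rw [← ENNReal.rpow_mul]; norm_num
  have e2 : ∀ y, K y ^ (1 / 2 : ℝ) * (K y ^ (1 / 2 : ℝ) * c y) = K y * c y := fun y => by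
    rw [← mul_assoc, ← ENNReal.rpow_add_of_nonneg _ _ (by norm_num) (by norm_num)]; norm_num
  have e3 : ∀ y, (K y ^ (1 / 2 : ℝ) * c y) ^ (2 : ℝ) = K y * c y ^ 2 := fun y => by
    rw [ENNReal.mul_rpow_of_nonneg _ _ (by norm_num), e1, ENNReal.rpow_two]
  simp only [Pi.mul_apply, lintegral_count, e1, e2, e3] at h
  have h2 := ENNReal.rpow_le_rpow h (show (0 : ℝ) ≤ 2 by norm_num)
  rw [ENNReal.mul_rpow_of_nonneg _ _ (by norm_num), ← ENNReal.rpow_mul, ← ENNReal.rpow_mul] at h2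
  norm_num at h2
  exact h2

/-- Cauchy–Schwarz with weight `K x ·` spends the row bound; exchanging the sums leaves the column
sums. -/
theorem schur_test {α β : Type*} (K : α → β → ℝ≥0∞) (c : β → ℝ≥0∞) {a b : ℝ≥0∞}
    (ha : ∀ x, ∑' y, K x y ≤ a) (hb : ∀ y, ∑' x, K x y ≤ b) :
    ∑' x, (∑' y, K x y * c y) ^ 2 ≤ a * b * ∑' y, c y ^ 2 := by
  calc ∑' x, (∑' y, K x y * c y) ^ 2
      ≤ ∑' x, a * ∑' y, K x y * c y ^ 2 :=
        ENNReal.tsum_le_tsum fun x => (sq_tsum_mul_le _ _).trans (mul_le_mul_left (ha x) _)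
    _ = a * ∑' y, (∑' x, K x y) * c y ^ 2 := by
        rw [ENNReal.tsum_mul_left, ENNReal.tsum_comm]
        simp_rw [ENNReal.tsum_mul_right]
    _ ≤ a * ∑' y, b * c y ^ 2 := by
        gcongr with y
        exact hb y
    _ = a * b * ∑' y, c y ^ 2 := by rw [ENNReal.tsum_mul_left, mul_assoc]

/-! ### Frames -/

section Frames

variable {ι H : Type*} [NormedAddCommGroup H] [InnerProductSpace ℂ H]

/-- The frame inequalities with given bounds, as inequalities between extended nonnegative
reals. -/
def HasFrameBounds (φ : ι → H) (A B : ℝ≥0) : Prop :=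
  ∀ f : H, (A : ℝ≥0∞) * ‖f‖ₑ ^ 2 ≤ ∑' i, ‖inner ℂ (φ i) f‖ₑ ^ 2 ∧
    ∑' i, ‖inner ℂ (φ i) f‖ₑ ^ 2 ≤ B * ‖f‖ₑ ^ 2

theorem enorm_sq_eq_ofReal {E : Type*} [SeminormedAddCommGroup E] (x : E) :
    ‖x‖ₑ ^ 2 = ENNReal.ofReal (‖x‖ ^ 2) := by
  rw [ENNReal.ofReal_pow (norm_nonneg _), ofReal_norm]

theorem coe_mul_enorm_sq {E : Type*} [SeminormedAddCommGroup E] (A : ℝ≥0) (x : E) :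
    (A : ℝ≥0∞) * ‖x‖ₑ ^ 2 = ENNReal.ofReal (A * ‖x‖ ^ 2) := by
  rw [enorm_sq_eq_ofReal, ENNReal.ofReal_mul A.coe_nonneg, ENNReal.ofReal_coe_nnreal]

/-- With extended nonnegative values, summability is part of the upper bound and sums may be
exchanged freely. -/
theorem isFrame_iff_hasFrameBounds {φ : ι → H} :
    IsFrame φ ↔ ∃ A B : ℝ≥0, 0 < A ∧ 0 < B ∧ HasFrameBounds φ A B := by
  constructor
  · rintro ⟨A, B, hA, hB, h⟩
    lift A to ℝ≥0 using hA.le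
    lift B to ℝ≥0 using hB.le
    refine ⟨A, B, by exact_mod_cast hA, by exact_mod_cast hB, fun f => ?_⟩
    obtain ⟨h1, h2, h3⟩ := h f
    rw [coe_mul_enorm_sq, coe_mul_enorm_sq]
    simp_rw [enorm_sq_eq_ofReal]
    rw [← ENNReal.ofReal_tsum_of_nonneg (fun _ => by positivity) h1]
    exact ⟨ENNReal.ofReal_le_ofReal h2, ENNReal.ofReal_le_ofReal h3⟩
  · rintro ⟨A, B, hA, hB, h⟩
    refine ⟨A, B, hA, hB, fun f => ?_⟩
    obtain ⟨h2, h3⟩ := h f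
    rw [coe_mul_enorm_sq] at h2 h3
    simp_rw [enorm_sq_eq_ofReal] at h2 h3
    have h1 : Summable fun i => ‖inner ℂ (φ i) f‖ ^ 2 :=
      summable_of_sum_le (c := B * ‖f‖ ^ 2) (fun _ => by positivity) fun u => by
        have := (ENNReal.sum_le_tsum u).trans h3
        rw [← ENNReal.ofReal_sum_of_nonneg (fun _ _ => by positivity)] at this
        exact (ENNReal.ofReal_le_ofReal_iff (by positivity)).1 this
    rw [← ENNReal.ofReal_tsum_of_nonneg (fun _ => by positivity) h1] at h2 h3
    exact ⟨h1, (ENNReal.ofReal_le_ofReal_iff (tsum_nonneg fun _ => by positivity)).1 h2,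
      (ENNReal.ofReal_le_ofReal_iff (by positivity)).1 h3⟩

theorem HasFrameBounds.memℓp {φ : ι → H} {A B : ℝ≥0} (h : HasFrameBounds φ A B) (f : H) :
    Memℓp (fun i => inner ℂ (φ i) f) 2 := by
  refine memℓp_gen ?_
  have := ((h f).2.trans_lt (ENNReal.mul_lt_top ENNReal.coe_lt_top (by finiteness))).ne
  simp_rw [enorm_sq_eq_ofReal] at this
  have h2 := ENNReal.summable_toReal this
  simpa [ENNReal.toReal_ofReal] using h2

theorem enorm_lp_sq (c : lp (fun _ : ι => ℂ) 2) : ‖c‖ₑ ^ 2 = ∑' i, ‖c i‖ₑ ^ 2 := by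
  have h := lp.hasSum_norm (p := 2) (by norm_num) c
  simp only [ENNReal.toReal_ofNat, Real.rpow_two] at h
  simp_rw [enorm_sq_eq_ofReal]
  rw [← h.tsum_eq, ENNReal.ofReal_tsum_of_nonneg (fun _ => by positivity) h.summable]

/-- The analysis operator of a frame. -/
def HasFrameBounds.analysis {φ : ι → H} {A B : ℝ≥0} (h : HasFrameBounds φ A B) :
    H →L[ℂ] lp (fun _ : ι => ℂ) 2 :=
  LinearMap.mkContinuousOfExistsBound
    { toFun := fun f => ⟨fun i => inner ℂ (φ i) f, h.memℓp f⟩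
      map_add' := fun f f' => by
        ext i
        exact inner_add_right _ _ _
      map_smul' := fun a f => by
        ext i
        exact inner_smul_right _ _ _ }
    ⟨NNReal.sqrt B, fun f => by
      have h1 := (h f).2
      rw [← enorm_lp_sq ⟨fun i => inner ℂ (φ i) f, h.memℓp f⟩, coe_mul_enorm_sq,
        enorm_sq_eq_ofReal, ENNReal.ofReal_le_ofReal_iff (by positivity)] at h1
      refine (pow_le_pow_iff_left₀ (norm_nonneg _) (by positivity) two_ne_zero).1 ?_
      rw [mul_pow]
      simpa using h1⟩

/-- Every vector has an expansion in a frame, with coefficients controlled by its norm. -/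
theorem HasFrameBounds.exists_expansion [CompleteSpace H] {φ : ι → H} {A B : ℝ≥0}
    (h : HasFrameBounds φ A B) (hA : 0 < A) :
    ∃ K : ℝ≥0, ∀ f : H, ∃ c : ι → ℂ, ∑' i, ‖c i‖ₑ ^ 2 ≤ K * ‖f‖ₑ ^ 2 ∧
      ∀ v : H, HasSum (fun i => inner ℂ v (φ i) * c i) (inner ℂ v f) := by
  set T := h.analysis
  -- The lower frame bound makes the frame operator `S` coercive, hence invertible. The coefficients
  -- are `T S⁻¹ f`, and the expansion is the weak form of `T* T S⁻¹ f = f`.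
  set S : H →L[ℂ] H := T.adjoint ∘L T
  have hS : ∀ x, ‖x‖ ^ 2 * A ≤ ‖inner ℂ (S x) x‖ := fun x => by
    have h1 := (h x).1
    have h2 : ‖T x‖ₑ ^ 2 = ∑' i, ‖inner ℂ (φ i) x‖ₑ ^ 2 := enorm_lp_sq _
    rw [← h2, coe_mul_enorm_sq, enorm_sq_eq_ofReal,
      ENNReal.ofReal_le_ofReal_iff (by positivity)] at h1
    have h3 : inner ℂ (S x) x = inner ℂ (T x) (T x) := by
      simp [S, ContinuousLinearMap.adjoint_inner_left]
    rw [h3, inner_self_eq_norm_sq_to_K, norm_pow]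
    simpa [mul_comm] using h1
  obtain ⟨U, hU⟩ := ContinuousLinearMap.isUnit_of_forall_le_norm_inner_map S hA hS
  set V : H →L[ℂ] H := (↑U⁻¹ : H →L[ℂ] H)
  have hV : ∀ f, S (V f) = f := fun f => by
    have : S * V = 1 := by rw [← hU]; exact U.mul_inv
    exact DFunLike.congr_fun this f
  refine ⟨‖T ∘L V‖₊ ^ 2, fun f => ⟨fun i => T (V f) i, ?_, fun v => ?_⟩⟩
  · rw [← enorm_lp_sq, ENNReal.coe_pow, ← mul_pow]
    gcongr
    exact (T ∘L V).le_opENorm f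
  · have h1 := lp.hasSum_inner (𝕜 := ℂ) (T v) (T (V f))
    have h2 : inner ℂ (T v) (T (V f)) = inner ℂ v f := by
      rw [← ContinuousLinearMap.adjoint_inner_right]
      exact congrArg _ (hV f)
    rw [h2] at h1
    have h3 : ∀ i, inner ℂ (T v i) (T (V f) i) = inner ℂ v (φ i) * T (V f) i := fun i => by
      rw [RCLike.inner_apply, mul_comm, ← inner_conj_symm v (φ i)]
      rfl
    simpa only [h3] using h1

end Frames

/-! ### Lattice sums -/

section Lattice

variable {ι : Type*}

/-- The vector with real coordinates underlying an integer vector. -/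
def intVec (k : ι → ℤ) : ι → ℝ := fun i => k i

theorem intVec_add (k l : ι → ℤ) : intVec (k + l) = intVec k + intVec l := by
  ext; simp [intVec]

theorem intVec_sub (k l : ι → ℤ) : intVec (k - l) = intVec k - intVec l := by
  ext; simp [intVec]

theorem intVec_injective : Function.Injective (intVec : (ι → ℤ) → ι → ℝ) := fun k l h => by
  ext i
  exact Int.cast_injective (congrFun h i)

variable [Fintype ι]

theorem exists_intVec_norm_sub_le (y : ι → ℝ) : ∃ p : ι → ℤ, ‖intVec p - y‖ ≤ 1 / 2 := by
  refine ⟨fun i => round (y i), (pi_norm_le_iff_of_nonneg (by norm_num)).2 fun i => ?_⟩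
  rw [Pi.sub_apply, norm_sub_rev]
  exact abs_sub_round (y i)

theorem exists_norm_sub_intVec_le_one (y : ι → ℝ) : ∃ p : ι → ℤ, ‖y - intVec p‖ ≤ 1 := by
  obtain ⟨p, hp⟩ := exists_intVec_norm_sub_le y
  exact ⟨p, by rw [norm_sub_rev]; linarith⟩

theorem summable_one_add_norm_intVec {σ : ℝ} (hσ : (Fintype.card ι : ℝ) < σ) :
    Summable fun k : ι → ℤ => (1 + ‖intVec k‖) ^ (-σ) := by
  classical
  let b := Pi.basisFun ℝ ι
  let L : Submodule ℤ (ι → ℝ) := Submodule.span ℤ (Set.range b)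
  have hfin : Module.finrank ℤ L = Fintype.card ι := by
    rw [ZLattice.rank ℝ L, Module.finrank_fintype_fun_eq_card]
  have hsum := ZLattice.summable_norm_rpow L (-σ) (by rw [hfin]; linarith)
  have hmem : ∀ k : ι → ℤ, intVec k ∈ L := fun k => by
    have : intVec k = ∑ i, k i • b i := by
      ext i
      simp [b, intVec, Finset.sum_apply, Pi.single_apply]
    rw [this]
    exact Submodule.sum_mem _ fun i _ => Submodule.smul_mem _ _ (Submodule.subset_span ⟨i, rfl⟩)
  have h1 : Summable fun k : ι → ℤ => ‖intVec k‖ ^ (-σ) :=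
    hsum.comp_injective (i := fun k => (⟨intVec k, hmem k⟩ : L))
      fun k l h => intVec_injective (congrArg Subtype.val h)
  -- The comparison fails only at `k = 0`, where the right side is `0 ^ (-σ) = 0`.
  refine Summable.of_norm_bounded_eventually h1 ?_
  filter_upwards [(Set.finite_singleton (0 : ι → ℤ)).compl_mem_cofinite] with k hk
  have hpos : 0 < ‖intVec k‖ := norm_pos_iff.2 fun h => hk (intVec_injective (by
    rw [h]; ext; simp [intVec]))
  rw [Real.norm_of_nonneg (by positivity)]
  exact Real.rpow_le_rpow_of_nonpos hpos (by linarith)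
    (by linarith [(Nat.cast_nonneg (Fintype.card ι) : (0 : ℝ) ≤ _)])

theorem one_add_norm_rpow_le {σ a b q : ℝ} (hσ : 0 ≤ σ) (ha : 0 ≤ a) (hb : 0 ≤ b) (hq : 0 < q)
    (h : 1 + b ≤ q * (1 + a)) : (1 + a) ^ (-σ) ≤ q ^ σ * (1 + b) ^ (-σ) := by
  have h1 : (q * (1 + a)) ^ (-σ) ≤ (1 + b) ^ (-σ) :=
    Real.rpow_le_rpow_of_nonpos (by positivity) h (by linarith)
  rw [Real.mul_rpow hq.le (by positivity)] at h1
  calc (1 + a) ^ (-σ) = q ^ σ * (q ^ (-σ) * (1 + a) ^ (-σ)) := by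
        rw [← mul_assoc, ← Real.rpow_add hq]; simp
    _ ≤ _ := by gcongr

/-- Recentre at an integer point `p` nearest to `θ⁻¹ y`. Since `θ ≥ 1/2`, one has `1 + ‖k - p‖ ≤ 2(1
+ ‖θk - y‖)`, so a single convergent sum dominates for all `θ` and `y`. -/
theorem exists_lattice_sum_le {σ : ℝ} (hσ : (Fintype.card ι : ℝ) < σ) :
    ∃ D : ℝ≥0, ∀ θ : ℝ, 1 / 2 ≤ θ → ∀ y : ι → ℝ,
      ∑' k : ι → ℤ, ENNReal.ofReal ((1 + ‖θ • intVec k - y‖) ^ (-σ)) ≤ D := by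
  have hσ0 : 0 ≤ σ := (Nat.cast_nonneg _).trans hσ.le
  have hs := summable_one_add_norm_intVec hσ
  refine ⟨(ENNReal.ofReal (2 ^ σ) *
    ∑' k : ι → ℤ, ENNReal.ofReal ((1 + ‖intVec k‖) ^ (-σ))).toNNReal, fun θ hθ y => ?_⟩
  rw [ENNReal.coe_toNNReal (ENNReal.mul_ne_top ENNReal.ofReal_ne_top hs.tsum_ofReal_ne_top)]
  obtain ⟨p, hp⟩ := exists_intVec_norm_sub_le (θ⁻¹ • y)
  rw [← (Equiv.subRight p).tsum_eq fun k => ENNReal.ofReal ((1 + ‖intVec k‖) ^ (-σ)),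
    ← ENNReal.tsum_mul_left]
  refine ENNReal.tsum_le_tsum fun k => ?_
  rw [← ENNReal.ofReal_mul (by positivity)]
  refine ENNReal.ofReal_le_ofReal
    (one_add_norm_rpow_le hσ0 (norm_nonneg _) (norm_nonneg _) two_pos ?_)
  rw [Equiv.subRight_apply, intVec_sub]
  have hθ0 : θ ≠ 0 := by linarith
  have h1 : ‖θ • intVec k - y‖ = θ * ‖intVec k - θ⁻¹ • y‖ := by
    rw [← Real.norm_of_nonneg (show 0 ≤ θ by linarith), ← norm_smul, smul_sub, smul_smul,
      Real.norm_of_nonneg (show 0 ≤ θ by linarith), mul_inv_cancel₀ hθ0, one_smul]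
  have h2 : ‖intVec k - intVec p‖ ≤ ‖intVec k - θ⁻¹ • y‖ + ‖intVec p - θ⁻¹ • y‖ :=
    (norm_sub_le_norm_sub_add_norm_sub _ (θ⁻¹ • y) _).trans_eq (by rw [norm_sub_rev (θ⁻¹ • y)])
  rw [h1]
  nlinarith [norm_nonneg (intVec k - θ⁻¹ • y)]

end Lattice

/-! ### A partition of space into tent functions -/

section Tent

variable {ι : Type*} [Fintype ι]

/-- The tent function of width `T` centered at `T j`. -/
def tent (T : ℝ) (j : ι → ℤ) (y : ι → ℝ) : ℝ := max (1 - ‖T⁻¹ • y - intVec j‖) 0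

theorem tent_nonneg (T : ℝ) (j : ι → ℤ) (y : ι → ℝ) : 0 ≤ tent T j y := le_max_right _ _

theorem tent_le_one (T : ℝ) (j : ι → ℤ) (y : ι → ℝ) : tent T j y ≤ 1 :=
  max_le (by linarith [norm_nonneg (T⁻¹ • y - intVec j)]) zero_le_one

theorem tent_eq_zero {T : ℝ} {j : ι → ℤ} {y : ι → ℝ} (h : 1 ≤ ‖T⁻¹ • y - intVec j‖) :
    tent T j y = 0 := max_eq_right (by linarith)

theorem abs_tent_sub_le {T : ℝ} (hT : 0 < T) (j : ι → ℤ) (x y : ι → ℝ) :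
    |tent T j x - tent T j y| ≤ ‖x - y‖ / T := by
  refine (abs_max_sub_max_le_abs _ _ _).trans ?_
  · have h : ‖x - y‖ / T = ‖(T⁻¹ • x - intVec j) - (T⁻¹ • y - intVec j)‖ := by
      rw [sub_sub_sub_cancel_right, ← smul_sub, norm_smul, Real.norm_of_nonneg (by positivity),
        div_eq_inv_mul]
    rw [h, sub_sub_sub_cancel_left, abs_sub_comm]
    exact abs_norm_sub_norm_le _ _

theorem abs_tent_sub_le_one (T : ℝ) (j : ι → ℤ) (x y : ι → ℝ) :
    |tent T j x - tent T j y| ≤ 1 :=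
  abs_sub_le_iff.2 ⟨by linarith [tent_nonneg T j y, tent_le_one T j x],
    by linarith [tent_nonneg T j x, tent_le_one T j y]⟩

/-- Interpolates between the Lipschitz bound and the trivial bound `1`, so that a gain of `T ^ (-α)`
costs only `α` orders of decay. -/
theorem abs_tent_sub_le_rpow {T α : ℝ} (hT : 0 < T) (hα : 0 ≤ α) (hα1 : α ≤ 1) (j : ι → ℤ)
    (x y : ι → ℝ) : |tent T j x - tent T j y| ≤ ((1 + ‖x - y‖) / T) ^ α := by
  rcases le_total ((1 + ‖x - y‖) / T) 1 with h | h
  · refine ((abs_tent_sub_le hT j x y).trans (by gcongr; linarith)).trans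
      (Real.self_le_rpow_of_le_one (by positivity) h hα1)
  · exact (abs_tent_sub_le_one T j x y).trans (Real.one_le_rpow h hα)

/-- The tent at the nearest centre is at least `1/2`. Only this lower bound is needed, not an exact
partition of unity. -/
theorem quarter_le_tsum_tent_sq (T : ℝ) (y : ι → ℝ) :
    ENNReal.ofReal (1 / 4) ≤ ∑' j : ι → ℤ, ENNReal.ofReal (tent T j y ^ 2) := by
  obtain ⟨p, hp⟩ := exists_intVec_norm_sub_le (T⁻¹ • y)
  refine le_trans (ENNReal.ofReal_le_ofReal ?_) (ENNReal.le_tsum p)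
  have : 1 / 2 ≤ tent T p y := le_max_of_le_left (by rw [norm_sub_rev]; linarith)
  nlinarith

/-- The indicator of the integer points at distance at most `ρ` from a given point. -/
def near (ρ : ℝ) (x : ι → ℝ) (j : ι → ℤ) : ℝ≥0∞ := open scoped Classical in
  if ‖x - intVec j‖ ≤ ρ then 1 else 0

theorem near_eq_one {ρ : ℝ} {x : ι → ℝ} {j : ι → ℤ} (h : ‖x - intVec j‖ ≤ ρ) : near ρ x j = 1 :=
  if_pos h

theorem exists_tsum_near_le (ι : Type*) [Fintype ι] {ρ : ℝ} (hρ : 0 ≤ ρ) :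
    ∃ N : ℝ≥0, 0 < N ∧ ∀ x : ι → ℝ, ∑' j, near ρ x j ≤ N := by
  obtain ⟨D, hD⟩ := exists_lattice_sum_le (ι := ι) (lt_add_one _)
  set σ : ℝ := Fintype.card ι + 1
  have hρ1 : 0 < 1 + ρ := by linarith
  -- The summand `1` keeps the bound positive, so that it can be a divisor later.
  refine ⟨Real.toNNReal ((1 + ρ) ^ σ) * (D + 1),
    mul_pos (Real.toNNReal_pos.2 (by positivity)) (by positivity), fun x => ?_⟩
  calc ∑' j, near ρ x j
      ≤ ∑' j, ENNReal.ofReal ((1 + ρ) ^ σ) *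
          ENNReal.ofReal ((1 + ‖(1 : ℝ) • intVec j - x‖) ^ (-σ)) := by
        refine ENNReal.tsum_le_tsum fun j => ?_
        unfold near
        split_ifs with h
        · rw [← ENNReal.ofReal_mul (by positivity), ← ENNReal.ofReal_one]
          refine ENNReal.ofReal_le_ofReal ?_
          have h2 : (1 + ρ) ^ (-σ) ≤ (1 + ‖(1 : ℝ) • intVec j - x‖) ^ (-σ) :=
            Real.rpow_le_rpow_of_nonpos (by positivity)
              (by rw [one_smul, norm_sub_rev]; linarith)
              (by linarith [(Nat.cast_nonneg _ : (0 : ℝ) ≤ Fintype.card ι)])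
          calc (1 : ℝ) = (1 + ρ) ^ σ * (1 + ρ) ^ (-σ) := by rw [← Real.rpow_add hρ1]; simp
            _ ≤ _ := by gcongr
        · exact zero_le
    _ ≤ ENNReal.ofReal ((1 + ρ) ^ σ) * D := by
        rw [ENNReal.tsum_mul_left]
        gcongr
        exact hD 1 (by norm_num) x
    _ ≤ _ := by
        rw [ENNReal.coe_mul, ENNReal.ofReal]
        gcongr
        exact le_self_add

theorem ofReal_tent_sq_le (T : ℝ) (j : ι → ℤ) (y : ι → ℝ) :
    ENNReal.ofReal (tent T j y ^ 2) ≤ near 2 (T⁻¹ • y) j := by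
  by_cases h : ‖T⁻¹ • y - intVec j‖ ≤ 2
  · rw [near_eq_one h, ← ENNReal.ofReal_one]
    exact ENNReal.ofReal_le_ofReal (pow_le_one₀ (tent_nonneg _ _ _) (tent_le_one _ _ _))
  · rw [tent_eq_zero (by linarith)]
    simp

/-- The variation of a tent function, damped by a polynomially decaying kernel. -/
theorem abs_tent_sub_mul_le {s α C T : ℝ} (hα : 0 ≤ α) (hα1 : α ≤ 1) (hαs : α ≤ s) (hC : 0 ≤ C)
    (hT : 1 ≤ T) (j : ι → ℤ) (x z v : ι → ℝ) (hv : ‖v‖ ≤ 1) :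
    ENNReal.ofReal (|tent T j x - tent T j (z + v)| * (C * (1 + ‖z + v - x‖) ^ (-s))) ≤
      (near 2 (T⁻¹ • x) j + near 2 (T⁻¹ • z) j) *
        (ENNReal.ofReal (C * T ^ (-α) * 2 ^ (s - α)) *
          ENNReal.ofReal ((1 + ‖z - x‖) ^ (-(s - α)))) := by
  have hT0 : 0 < T := by linarith
  -- If neither `x` nor `z` is within `2` of the centre after rescaling, then both tents vanish: the
  -- rescaled shift by `v` has norm at most `1`. This is why the radius is `2` although a tent has
  -- radius `1`.
  by_cases h : 1 ≤ near 2 (T⁻¹ • x) j + near 2 (T⁻¹ • z) j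
  · refine le_trans ?_ (mul_le_mul_left h _)
    rw [one_mul, ← ENNReal.ofReal_mul (by positivity)]
    refine ENNReal.ofReal_le_ofReal ?_
    have h1 := abs_tent_sub_le_rpow hT0 hα hα1 j x (z + v)
    rw [norm_sub_rev] at h1
    set a := ‖z + v - x‖ with ha
    have h2 : (1 + a) ^ (-(s - α)) ≤ 2 ^ (s - α) * (1 + ‖z - x‖) ^ (-(s - α)) := by
      refine one_add_norm_rpow_le (by linarith) (norm_nonneg _) (norm_nonneg _) two_pos ?_
      have : ‖z - x‖ ≤ a + ‖v‖ := by
        have := norm_sub_le (z + v - x) v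
        rwa [show z + v - x - v = z - x by abel] at this
      linarith [norm_nonneg (z + v - x)]
    have ha0 : 0 < 1 + a := by positivity
    calc |tent T j x - tent T j (z + v)| * (C * (1 + a) ^ (-s))
        ≤ ((1 + a) / T) ^ α * (C * (1 + a) ^ (-s)) := by gcongr
      _ = C * T ^ (-α) * (1 + a) ^ (-(s - α)) := by
        rw [Real.div_rpow ha0.le hT0.le, Real.rpow_neg hT0.le, show -(s - α) = α + -s by ring,
          Real.rpow_add ha0]
        ring
      _ ≤ C * T ^ (-α) * (2 ^ (s - α) * (1 + ‖z - x‖) ^ (-(s - α))) := by gcongr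
      _ = _ := by ring
  · have hx : 2 ≤ ‖T⁻¹ • x - intVec j‖ := by
      by_contra! hlt
      exact h (by rw [near_eq_one hlt.le]; exact le_self_add)
    have hz : 2 ≤ ‖T⁻¹ • z - intVec j‖ := by
      by_contra! hlt
      exact h (by rw [near_eq_one hlt.le]; exact le_add_self)
    have hz' : 1 ≤ ‖T⁻¹ • (z + v) - intVec j‖ := by
      have h1 := norm_sub_le (T⁻¹ • (z + v) - intVec j) (T⁻¹ • v)
      rw [show T⁻¹ • (z + v) - intVec j - T⁻¹ • v = T⁻¹ • z - intVec j by
        rw [smul_add]; abel] at h1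
      have h2 : ‖T⁻¹ • v‖ ≤ 1 := by
        rw [norm_smul, Real.norm_of_nonneg (by positivity)]
        exact mul_le_one₀ (inv_le_one_of_one_le₀ hT) (norm_nonneg _) hv
      linarith
    rw [tent_eq_zero (by linarith : 1 ≤ ‖T⁻¹ • x - intVec j‖), tent_eq_zero hz']
    simp

end Tent

/-! ### Localizing an expansion -/

section Localization

variable {ι H : Type*} [Fintype ι] [NormedAddCommGroup H] [InnerProductSpace ℂ H]

/-- Ensures that the `finsum` in `localPart` is a genuine finite sum and not the default value `0`.
-/
theorem finite_tent_intVec_ne_zero {T : ℝ} (hT : 0 < T) (j : ι → ℤ) :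
    {k : ι → ℤ | tent T j (intVec k) ≠ 0}.Finite := by
  classical
  refine (Set.finite_Icc (fun i => ⌊T * j i - T⌋) (fun i => ⌈T * j i + T⌉)).subset fun k hk => ?_
  have h1 : ‖T⁻¹ • intVec k - intVec j‖ < 1 := by
    by_contra! h
    exact hk (tent_eq_zero h)
  have h2 : ∀ i, |(k i : ℝ) - T * j i| ≤ T := fun i => by
    have h3 := (norm_le_pi_norm (T⁻¹ • intVec k - intVec j) i).trans h1.le
    rw [show (k i : ℝ) - T * j i = T * (T⁻¹ • intVec k - intVec j) i by
      simp [intVec]; field_simp, abs_mul, abs_of_pos hT]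
    exact mul_le_of_le_one_right hT.le h3
  refine Set.mem_Icc.2 ⟨fun i => ?_, fun i => ?_⟩
  · exact Int.cast_le.1 ((Int.floor_le _).trans (by linarith [(abs_le.1 (h2 i)).1]))
  · exact Int.cast_le.1 (le_trans (by linarith [(abs_le.1 (h2 i)).2]) (Int.le_ceil _))

/-- Localization of the expansion with coefficients `c` near the point `T j`. -/
def localPart (e : (ι → ℝ) → H) (c : (ι → ℤ) → ℂ) (T : ℝ) (j : ι → ℤ) : H :=
  ∑ᶠ k : ι → ℤ, ((tent T j (intVec k) : ℂ) * c k) • e (intVec k)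

theorem hasSum_localPart (e : (ι → ℝ) → H) (c : (ι → ℤ) → ℂ) {T : ℝ} (hT : 0 < T) (j : ι → ℤ)
    (v : H) :
    HasSum (fun k => (tent T j (intVec k) : ℂ) * (inner ℂ v (e (intVec k)) * c k))
      (inner ℂ v (localPart e c T j)) := by
  have hfin := finite_tent_intVec_ne_zero hT j
  have h1 : localPart e c T j =
      ∑ k ∈ hfin.toFinset, ((tent T j (intVec k) : ℂ) * c k) • e (intVec k) := by
    refine finsum_eq_sum_of_support_subset _ fun k hk => ?_
    simp only [Set.Finite.coe_toFinset, Set.mem_ofPred_eq]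
    rintro h
    exact hk (by simp [h])
  rw [h1, inner_sum]
  simp_rw [inner_smul_right]
  have h2 : ∀ k, (tent T j (intVec k) : ℂ) * c k * inner ℂ v (e (intVec k)) =
      (tent T j (intVec k) : ℂ) * (inner ℂ v (e (intVec k)) * c k) := fun k => by ring
  simp_rw [h2]
  refine hasSum_sum_of_ne_finset_zero fun k hk => ?_
  have : tent T j (intVec k) = 0 := by simpa using hk
  simp [this]

/-- The failure of the localization of an expansion to act as multiplication by a tent on the
coefficients. -/
def localError (e : (ι → ℝ) → H) (c : (ι → ℤ) → ℂ) (f : H) (T : ℝ) (j : ι → ℤ) (y : ι → ℝ) : ℂ :=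
  inner ℂ (e y) (localPart e c T j) - tent T j y * inner ℂ (e y) f

/-- Expanding both terms with the same `c` exhibits the error as a commutator: Gram entries weighted
by differences of tent values. -/
theorem enorm_localError_le {e : (ι → ℝ) → H} {c : (ι → ℤ) → ℂ} {f : H}
    (hf : ∀ v : H, HasSum (fun k => inner ℂ v (e (intVec k)) * c k) (inner ℂ v f)) {T : ℝ}
    (hT : 0 < T) (j : ι → ℤ) (y : ι → ℝ) :
    ‖localError e c f T j y‖ₑ ≤ ∑' k, ENNReal.ofReal
      (|tent T j (intVec k) - tent T j y| * ‖inner ℂ (e y) (e (intVec k))‖) * ‖c k‖ₑ := by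
  have h := (hasSum_localPart e c hT j (e y)).sub ((hf (e y)).mul_left (tent T j y : ℂ))
  rw [localError, ← h.tsum_eq]
  refine enorm_tsum_le_tsum_enorm.trans (ENNReal.tsum_le_tsum fun k => le_of_eq ?_)
  rw [← sub_mul, ← mul_assoc, enorm_mul, enorm_mul, ENNReal.ofReal_mul (abs_nonneg _),
    ofReal_norm, ← Complex.ofReal_sub, ← ofReal_norm, Complex.norm_real, Real.norm_eq_abs]

/-- Localization errors are small at large scales, uniformly over separated sampling sets which
may depend on the position. -/
theorem exists_localError_le {e : (ι → ℝ) → H} {s C : ℝ} (hs : (Fintype.card ι : ℝ) < s)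
    (hC : 0 ≤ C) (he : ∀ x y, ‖inner ℂ (e x) (e y)‖ ≤ C * (1 + ‖x - y‖) ^ (-s)) {η : ℝ≥0}
    (hη : 0 < η) :
    ∃ T₀ : ℝ, 1 ≤ T₀ ∧ ∀ T, T₀ ≤ T → ∀ θ : ℝ, 1 / 2 ≤ θ → ∀ w : (ι → ℤ) → ι → ℝ,
      (∀ j, ‖w j‖ ≤ 1) → ∀ (c : (ι → ℤ) → ℂ) (f : H),
      (∀ v : H, HasSum (fun k => inner ℂ v (e (intVec k)) * c k) (inner ℂ v f)) →
      ∑' j, ∑' m, ‖localError e c f T j (θ • intVec m + w j)‖ₑ ^ 2 ≤ η * ∑' k, ‖c k‖ₑ ^ 2 := by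
  -- Only part of the surplus decay is spent, so the remaining exponent `s - α` is still summable.
  obtain ⟨α, hα0, hα1, hαs⟩ : ∃ α : ℝ, 0 < α ∧ α ≤ 1 ∧ (Fintype.card ι : ℝ) < s - α :=
    ⟨min 1 ((s - Fintype.card ι) / 2), lt_min one_pos (by linarith), min_le_left _ _, by
      linarith [min_le_right 1 ((s - Fintype.card ι) / 2)]⟩
  have hcard : (0 : ℝ) ≤ Fintype.card ι := Nat.cast_nonneg _
  obtain ⟨D, hD⟩ := exists_lattice_sum_le hαs
  obtain ⟨N, hN0, hN⟩ := exists_tsum_near_le ι (zero_le_two (α := ℝ))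
  have hlim : Filter.Tendsto (fun T : ℝ => (2 * (ENNReal.ofReal (C * T ^ (-α) * 2 ^ (s - α)) * D)) *
      (2 * N * (ENNReal.ofReal (C * T ^ (-α) * 2 ^ (s - α)) * D))) Filter.atTop (nhds 0) := by
    have h1 : Filter.Tendsto (fun T : ℝ => ENNReal.ofReal (C * T ^ (-α) * 2 ^ (s - α)))
        Filter.atTop (nhds 0) := by
      have := ((tendsto_rpow_neg_atTop hα0).const_mul C).mul_const (2 ^ (s - α))
      simpa using ENNReal.tendsto_ofReal this
    have h2 := ENNReal.Tendsto.mul_const (b := (D : ℝ≥0∞)) h1 (Or.inr ENNReal.coe_ne_top)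
    rw [zero_mul] at h2
    have h3 := ENNReal.Tendsto.const_mul (a := 2) h2 (Or.inr (by finiteness))
    have h4 := ENNReal.Tendsto.const_mul (a := 2 * (N : ℝ≥0∞)) h2 (Or.inr (by finiteness))
    rw [mul_zero] at h3 h4
    simpa using ENNReal.Tendsto.mul h3 (Or.inr (by simp)) h4 (Or.inr (by simp))
  obtain ⟨T₁, hT₁⟩ := Filter.eventually_atTop.1
    (hlim.eventually (Iic_mem_nhds (show (0 : ℝ≥0∞) < η by exact_mod_cast hη)))
  refine ⟨max 1 T₁, le_max_left _ _, fun T hT θ hθ w hw c f hf => ?_⟩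
  have hT1 : 1 ≤ T := (le_max_left _ _).trans hT
  set κ := ENNReal.ofReal (C * T ^ (-α) * 2 ^ (s - α))
  -- This kernel no longer involves `w`. Rows fix the centre and use `near ≤ 1`; columns also sum
  -- over centres, and there the bounded overlap `N` enters. Both sums carry the factor `κ`, which
  -- tends to `0` as `T` grows.
  set Q : (ι → ℤ) × (ι → ℤ) → (ι → ℤ) → ℝ≥0∞ := fun p k =>
    (near 2 (T⁻¹ • intVec k) p.1 + near 2 (T⁻¹ • θ • intVec p.2) p.1) *
      (κ * ENNReal.ofReal ((1 + ‖θ • intVec p.2 - intVec k‖) ^ (-(s - α))))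
  have hle : ∀ p : (ι → ℤ) × (ι → ℤ),
      ‖localError e c f T p.1 (θ • intVec p.2 + w p.1)‖ₑ ≤ ∑' k, Q p k * ‖c k‖ₑ := fun p => by
    refine (enorm_localError_le hf (by linarith) _ _).trans (ENNReal.tsum_le_tsum fun k => ?_)
    gcongr
    refine le_trans (ENNReal.ofReal_le_ofReal ?_)
      (abs_tent_sub_mul_le hα0.le hα1 (by linarith) hC hT1 p.1 (intVec k) (θ • intVec p.2) (w p.1)
        (hw _))
    gcongr
    exact he _ _
  have near_le : ∀ (x : ι → ℝ) j, near 2 x j ≤ 1 := fun x j => by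
    unfold near; split_ifs <;> simp
  have hrow : ∀ p, ∑' k, Q p k ≤ 2 * (κ * D) := fun p => by
    calc ∑' k, Q p k ≤ ∑' k, 2 * (κ *
          ENNReal.ofReal ((1 + ‖(1 : ℝ) • intVec k - θ • intVec p.2‖) ^ (-(s - α)))) := by
          refine ENNReal.tsum_le_tsum fun k => ?_
          rw [one_smul, norm_sub_rev]
          refine mul_le_mul_left ?_ _
          exact le_of_le_of_eq (add_le_add (near_le _ _) (near_le _ _)) one_add_one_eq_two
      _ ≤ _ := by
          rw [ENNReal.tsum_mul_left, ENNReal.tsum_mul_left]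
          gcongr
          exact hD 1 (by norm_num) _
  have hcol : ∀ k, ∑' p, Q p k ≤ 2 * N * (κ * D) := fun k => by
    rw [ENNReal.tsum_prod', ENNReal.tsum_comm]
    calc ∑' m, ∑' j, Q (j, m) k
        ≤ ∑' m, 2 * N * (κ * ENNReal.ofReal ((1 + ‖θ • intVec m - intVec k‖) ^ (-(s - α)))) := by
          refine ENNReal.tsum_le_tsum fun m => ?_
          simp only [Q]
          rw [ENNReal.tsum_mul_right, ENNReal.tsum_add, two_mul (N : ℝ≥0∞)]
          gcongr <;> exact hN _
      _ ≤ _ := by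
          rw [ENNReal.tsum_mul_left, ENNReal.tsum_mul_left]
          gcongr
          exact hD θ hθ _
  rw [← ENNReal.tsum_prod (f := fun j m => ‖localError e c f T j (θ • intVec m + w j)‖ₑ ^ 2)]
  calc ∑' p : (ι → ℤ) × (ι → ℤ), ‖localError e c f T p.1 (θ • intVec p.2 + w p.1)‖ₑ ^ 2
      ≤ ∑' p, (∑' k, Q p k * ‖c k‖ₑ) ^ 2 := ENNReal.tsum_le_tsum fun p => by
        gcongr; exact hle p
    _ ≤ _ := schur_test Q _ hrow hcol
    _ ≤ _ := by
        gcongr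
        exact hT₁ T ((le_max_right _ _).trans hT)

/-- Bessel's inequality for sampled families with polynomially decaying Gram matrix. -/
theorem exists_bessel_bound {e : (ι → ℝ) → H} {s C : ℝ} (hs : (Fintype.card ι : ℝ) < s)
    (hC : 0 ≤ C) (he : ∀ x y, ‖inner ℂ (e x) (e y)‖ ≤ C * (1 + ‖x - y‖) ^ (-s)) :
    ∃ B : ℝ≥0, ∀ θ : ℝ, 1 / 2 ≤ θ → ∀ (c : (ι → ℤ) → ℂ) (f : H),
      (∀ v : H, HasSum (fun k => inner ℂ v (e (intVec k)) * c k) (inner ℂ v f)) →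
      ∑' m, ‖inner ℂ (e (θ • intVec m)) f‖ₑ ^ 2 ≤ B * ∑' k, ‖c k‖ₑ ^ 2 := by
  obtain ⟨D, hD⟩ := exists_lattice_sum_le hs
  refine ⟨(C.toNNReal * D) * (C.toNNReal * D), fun θ hθ c f hf => ?_⟩
  set Q : (ι → ℤ) → (ι → ℤ) → ℝ≥0∞ := fun m k => ENNReal.ofReal C *
    ENNReal.ofReal ((1 + ‖θ • intVec m - intVec k‖) ^ (-s))
  have hle : ∀ m, ‖inner ℂ (e (θ • intVec m)) f‖ₑ ≤ ∑' k, Q m k * ‖c k‖ₑ := fun m => by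
    rw [← (hf _).tsum_eq]
    refine enorm_tsum_le_tsum_enorm.trans (ENNReal.tsum_le_tsum fun k => ?_)
    rw [enorm_mul, ← ofReal_norm]
    simp only [Q]
    rw [← ENNReal.ofReal_mul hC]
    gcongr
    exact he _ _
  have hrow : ∀ m, ∑' k, Q m k ≤ ENNReal.ofReal C * D := fun m => by
    simp only [Q]
    rw [ENNReal.tsum_mul_left]
    gcongr
    simpa [norm_sub_rev] using hD 1 (by norm_num) (θ • intVec m)
  have hcol : ∀ k, ∑' m, Q m k ≤ ENNReal.ofReal C * D := fun k => by
    simp only [Q]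
    rw [ENNReal.tsum_mul_left]
    gcongr
    exact hD θ hθ _
  calc ∑' m, ‖inner ℂ (e (θ • intVec m)) f‖ₑ ^ 2
      ≤ ∑' m, (∑' k, Q m k * ‖c k‖ₑ) ^ 2 := ENNReal.tsum_le_tsum fun m => by
        gcongr; exact hle m
    _ ≤ _ := schur_test Q _ hrow hcol
    _ = _ := by simp [ENNReal.ofReal]

end Localization

/-! ### Dilating a covariant frame -/

section Dilation

theorem ennreal_add_sq_le (a b : ℝ≥0∞) : (a + b) ^ 2 ≤ 2 * a ^ 2 + 2 * b ^ 2 := by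
  have h := ENNReal.rpow_add_le_mul_rpow_add_rpow a b (one_le_two : (1 : ℝ) ≤ 2)
  norm_num at h
  rwa [← mul_add]

variable {ι H : Type*} [NormedAddCommGroup H] [InnerProductSpace ℂ H]
  {e : (ι → ℝ) → H}


/-- Covariance: translating the family by `w` has the same effect on moduli of coefficients as
an isometric change of the analyzed vector. -/
def IsCovariant (e : (ι → ℝ) → H) : Prop :=
  ∀ (w : ι → ℝ) (f : H), ∃ f' : H, ‖f'‖ = ‖f‖ ∧
    ∀ y, ‖inner ℂ (e (y + w)) f‖ = ‖inner ℂ (e y) f'‖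

theorem IsCovariant.lower_bound (hcov : IsCovariant e) {A B : ℝ≥0}
    (h : HasFrameBounds (fun k : ι → ℤ => e (intVec k)) A B) (w : ι → ℝ) (f : H) :
    A * ‖f‖ₑ ^ 2 ≤ ∑' m : ι → ℤ, ‖inner ℂ (e (intVec m + w)) f‖ₑ ^ 2 := by
  obtain ⟨f', h1, h2⟩ := hcov w f
  simp_rw [enorm_sq_eq_ofReal, h2, ← h1]
  simpa only [enorm_sq_eq_ofReal] using (h f').1

/-- Covariance carries `y` to the origin, so closeness of `e u` to `e 0` gives a bound uniform in
`y`. -/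
theorem IsCovariant.enorm_inner_add_sq_le (hcov : IsCovariant e) {u : ι → ℝ} {δ : ℝ≥0}
    (hu : ‖e u - e 0‖ ≤ δ) (y : ι → ℝ) (f : H) :
    ‖inner ℂ (e (y + u)) f‖ₑ ^ 2 ≤ 2 * ‖inner ℂ (e y) f‖ₑ ^ 2 + 2 * (δ ^ 2 * ‖f‖ₑ ^ 2) := by
  obtain ⟨f', h1, h2⟩ := hcov y f
  have h3 := h2 0
  rw [zero_add] at h3
  have h4 : ‖inner ℂ (e (y + u)) f‖ ≤ ‖inner ℂ (e y) f‖ + δ * ‖f‖ := by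
    rw [add_comm, h2 u, h3, ← h1]
    have : inner ℂ (e u) f' = inner ℂ (e 0) f' + inner ℂ (e u - e 0) f' := by
      rw [inner_sub_left]; ring
    rw [this]
    refine (norm_add_le _ _).trans ?_
    gcongr
    exact (norm_inner_le_norm _ _).trans (by gcongr)
  rw [← mul_pow]
  refine le_trans (pow_le_pow_left₀ zero_le ?_ 2) (ennreal_add_sq_le _ _)
  have h5 := ENNReal.ofReal_le_ofReal h4
  rwa [ENNReal.ofReal_add (norm_nonneg _) (by positivity), ENNReal.ofReal_mul δ.coe_nonneg,
    ofReal_norm, ofReal_norm, ofReal_norm, ENNReal.ofReal_coe_nnreal] at h5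

variable [Fintype ι]

theorem enorm_tent_sq (T : ℝ) (j : ι → ℤ) (y : ι → ℝ) :
    ‖(tent T j y : ℂ)‖ₑ ^ 2 = ENNReal.ofReal (tent T j y ^ 2) := by
  rw [enorm_sq_eq_ofReal, Complex.norm_real, Real.norm_eq_abs, sq_abs]

theorem tent_sq_mul_enorm_inner_sq_le (e : (ι → ℝ) → H) (c : (ι → ℤ) → ℂ) (f : H) (T : ℝ)
    (j : ι → ℤ) (y : ι → ℝ) :
    ENNReal.ofReal (tent T j y ^ 2) * ‖inner ℂ (e y) f‖ₑ ^ 2 ≤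
      2 * ‖inner ℂ (e y) (localPart e c T j)‖ₑ ^ 2 + 2 * ‖localError e c f T j y‖ₑ ^ 2 := by
  rw [← enorm_tent_sq, ← mul_pow, ← enorm_mul]
  refine le_trans (pow_le_pow_left₀ zero_le ?_ 2) (ennreal_add_sq_le _ _)
  have h : (tent T j y : ℂ) * inner ℂ (e y) f =
      inner ℂ (e y) (localPart e c T j) - localError e c f T j y := by
    rw [localError]; ring
  rw [h]
  exact enorm_sub_le

theorem enorm_inner_localPart_sq_le (e : (ι → ℝ) → H) (c : (ι → ℤ) → ℂ) (f : H) (T : ℝ)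
    (j : ι → ℤ) (y : ι → ℝ) :
    ‖inner ℂ (e y) (localPart e c T j)‖ₑ ^ 2 ≤
      2 * (ENNReal.ofReal (tent T j y ^ 2) * ‖inner ℂ (e y) f‖ₑ ^ 2) +
        2 * ‖localError e c f T j y‖ₑ ^ 2 := by
  rw [← enorm_tent_sq, ← mul_pow, ← enorm_mul]
  refine le_trans (pow_le_pow_left₀ zero_le ?_ 2) (ennreal_add_sq_le _ _)
  have h : inner ℂ (e y) (localPart e c T j) =
      (tent T j y : ℂ) * inner ℂ (e y) f + localError e c f T j y := by
    rw [localError]; ring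
  rw [h]
  exact enorm_add_le _ _

/-- The frame inequality for a localized vector, with the translated lattice `ℤ^ι + τ R j` replaced
by the dilated one in the vicinity of the point `(1 + τ) R j`. -/
theorem IsCovariant.lower_bound_localPart (hcov : IsCovariant e) {A B : ℝ≥0}
    (h : HasFrameBounds (fun k : ι → ℤ => e (intVec k)) A B) {R τ T r : ℝ} {δ N : ℝ≥0}
    (hT0 : 0 < T) (hT : T = (1 + τ) * R) (hTR : T ≤ 2 * R) (hr : |τ| * (2 * R) < r)
    (hδ : ∀ u, ‖u‖ < r → ‖e u - e 0‖ ≤ δ) (hN : ∀ x : ι → ℝ, ∑' m, near (2 * R) x m ≤ N)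
    (hNδ : 2 * N * δ ^ 2 ≤ A / 2) (c : (ι → ℤ) → ℂ) (f : H) (j : ι → ℤ) :
    ((A / 2 : ℝ≥0) : ℝ≥0∞) * ‖localPart e c T j‖ₑ ^ 2 ≤
      ∑' m, ‖localError e c f T j (intVec m + (τ * R) • intVec j)‖ₑ ^ 2 +
      4 * ∑' m, ‖localError e c f T j ((1 + τ) • intVec m)‖ₑ ^ 2 +
      4 * ∑' m, ENNReal.ofReal (tent T j ((1 + τ) • intVec m) ^ 2) *
        ‖inner ℂ (e ((1 + τ) • intVec m)) f‖ₑ ^ 2 := by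
  set F := localPart e c T j with hF
  have hterm : ∀ m : ι → ℤ, ‖inner ℂ (e (intVec m + (τ * R) • intVec j)) F‖ₑ ^ 2 ≤
      (‖localError e c f T j (intVec m + (τ * R) • intVec j)‖ₑ ^ 2 +
      4 * ‖localError e c f T j ((1 + τ) • intVec m)‖ₑ ^ 2 +
      4 * (ENNReal.ofReal (tent T j ((1 + τ) • intVec m) ^ 2) *
        ‖inner ℂ (e ((1 + τ) • intVec m)) f‖ₑ ^ 2)) +
      near (2 * R) (R • intVec j) m * (2 * (δ ^ 2 * ‖F‖ₑ ^ 2)) := fun m => by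
    -- Inside the window the translated sample lies within `r` of the dilated one. Outside it the
    -- tent vanishes at the translated sample, because `T ≤ 2R`, and the coefficient is pure
    -- localization error.
    by_cases hm : ‖R • intVec j - intVec m‖ ≤ 2 * R
    · rw [near_eq_one hm, one_mul]
      have h1 : intVec m + (τ * R) • intVec j =
          (1 + τ) • intVec m + τ • (R • intVec j - intVec m) := by
        rw [add_smul, smul_sub, smul_smul, one_smul]; abel
      have h2 : ‖τ • (R • intVec j - intVec m)‖ < r := by
        rw [norm_smul, Real.norm_eq_abs]
        exact lt_of_le_of_lt (by gcongr) hr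
      conv_lhs => rw [h1]
      refine (hcov.enorm_inner_add_sq_le (hδ _ h2) _ F).trans ?_
      refine add_le_add_left ?_ _
      refine le_trans (mul_le_mul_right
        (enorm_inner_localPart_sq_le e c f T j ((1 + τ) • intVec m)) 2) ?_
      refine le_of_eq_of_le (b := 4 * ‖localError e c f T j ((1 + τ) • intVec m)‖ₑ ^ 2 +
        4 * (ENNReal.ofReal (tent T j ((1 + τ) • intVec m) ^ 2) *
          ‖inner ℂ (e ((1 + τ) • intVec m)) f‖ₑ ^ 2)) (by ring) ?_
      rw [add_assoc]
      exact le_add_self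
    · have h1 : tent T j (intVec m + (τ * R) • intVec j) = 0 := by
        refine tent_eq_zero ?_
        have h2 : T⁻¹ • (intVec m + (τ * R) • intVec j) - intVec j =
            T⁻¹ • (intVec m - R • intVec j) := by
          ext i
          simp only [Pi.sub_apply, Pi.smul_apply, Pi.add_apply, smul_eq_mul]
          field_simp
          rw [hT]
          ring
        rw [h2, norm_smul, Real.norm_of_nonneg (by positivity), norm_sub_rev, inv_mul_eq_div,
          one_le_div hT0]
        linarith
      have h4 : inner ℂ (e (intVec m + (τ * R) • intVec j)) F =
          localError e c f T j (intVec m + (τ * R) • intVec j) := by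
        simp [localError, h1, hF]
      rw [h4, add_assoc, add_assoc]
      exact le_self_add
  have h1 := (hcov.lower_bound h ((τ * R) • intVec j) F).trans (ENNReal.tsum_le_tsum hterm)
  rw [ENNReal.tsum_add, ENNReal.tsum_add, ENNReal.tsum_add, ENNReal.tsum_mul_left,
    ENNReal.tsum_mul_left, ENNReal.tsum_mul_right] at h1
  -- At most `N` samples are moved, and their total cost is absorbed by half of the lower bound `A`.
  have h2 : (∑' m, near (2 * R) (R • intVec j) m) * (2 * (δ ^ 2 * ‖F‖ₑ ^ 2)) ≤
      ((A / 2 : ℝ≥0) : ℝ≥0∞) * ‖F‖ₑ ^ 2 := by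
    calc _ ≤ (N : ℝ≥0∞) * (2 * (δ ^ 2 * ‖F‖ₑ ^ 2)) := by gcongr; exact hN _
      _ = ((2 * N * δ ^ 2 : ℝ≥0) : ℝ≥0∞) * ‖F‖ₑ ^ 2 := by push_cast; ring
      _ ≤ _ := by gcongr
  have h3 : (A : ℝ≥0∞) * ‖F‖ₑ ^ 2 =
      ((A / 2 : ℝ≥0) : ℝ≥0∞) * ‖F‖ₑ ^ 2 + ((A / 2 : ℝ≥0) : ℝ≥0∞) * ‖F‖ₑ ^ 2 := by
    rw [← add_mul, ← ENNReal.coe_add, add_halves]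
  rw [h3] at h1
  exact (ENNReal.add_le_add_iff_right (by finiteness)).1 (h1.trans (add_le_add_right h2 _))

/-- The total energy of the localizations controls the norm. -/
theorem HasFrameBounds.le_tsum_localPart {A B : ℝ≥0}
    (h : HasFrameBounds (fun k : ι → ℤ => e (intVec k)) A B) {E : ℝ≥0∞} {T : ℝ}
    (c : (ι → ℤ) → ℂ) (f : H) (hE : ∑' j, ∑' m, ‖localError e c f T j (intVec m)‖ₑ ^ 2 ≤ E) :
    ((A / 4 : ℝ≥0) : ℝ≥0∞) * ‖f‖ₑ ^ 2 ≤ 2 * B * ∑' j, ‖localPart e c T j‖ₑ ^ 2 + 2 * E := by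
  have h4 : ((A / 4 : ℝ≥0) : ℝ≥0∞) = ENNReal.ofReal (1 / 4) * A := by
    rw [← ENNReal.ofReal_coe_nnreal, ← ENNReal.ofReal_coe_nnreal (p := A),
      ← ENNReal.ofReal_mul (by norm_num)]
    congr 1
    push_cast
    ring
  calc ((A / 4 : ℝ≥0) : ℝ≥0∞) * ‖f‖ₑ ^ 2
      ≤ ENNReal.ofReal (1 / 4) * ∑' m : ι → ℤ, ‖inner ℂ (e (intVec m)) f‖ₑ ^ 2 := by
        rw [h4, mul_assoc]
        exact mul_le_mul_right (h f).1 _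
    _ ≤ ∑' m : ι → ℤ, ∑' j, ENNReal.ofReal (tent T j (intVec m) ^ 2) *
          ‖inner ℂ (e (intVec m)) f‖ₑ ^ 2 := by
        rw [← ENNReal.tsum_mul_left]
        refine ENNReal.tsum_le_tsum fun m => ?_
        rw [ENNReal.tsum_mul_right]
        exact mul_le_mul_left (quarter_le_tsum_tent_sq T _) _
    _ ≤ ∑' j, (2 * (B * ‖localPart e c T j‖ₑ ^ 2) +
          2 * ∑' m, ‖localError e c f T j (intVec m)‖ₑ ^ 2) := by
        rw [ENNReal.tsum_comm]
        refine ENNReal.tsum_le_tsum fun j => ?_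
        refine (ENNReal.tsum_le_tsum fun m =>
          tent_sq_mul_enorm_inner_sq_le e c f T j (intVec m)).trans ?_
        rw [ENNReal.tsum_add, ENNReal.tsum_mul_left, ENNReal.tsum_mul_left]
        gcongr
        exact (h _).2
    _ ≤ _ := by
        rw [ENNReal.tsum_add, ENNReal.tsum_mul_left, ENNReal.tsum_mul_left, ENNReal.tsum_mul_left,
          ← mul_assoc]
        gcongr

/-- Frames arising by sampling a covariant, continuous family with polynomially decaying
correlations on a lattice are stable under small dilations of the lattice. -/
theorem exists_isFrame_dilation [CompleteSpace H] {s C : ℝ} (hs : (Fintype.card ι : ℝ) < s)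
    (hC : 0 ≤ C) (he : ∀ x y, ‖inner ℂ (e x) (e y)‖ ≤ C * (1 + ‖x - y‖) ^ (-s))
    (hcov : IsCovariant e) (hcont : ContinuousAt e 0)
    (hframe : IsFrame fun k : ι → ℤ => e (intVec k)) :
    ∃ ε₀ : ℝ, 0 < ε₀ ∧ ∀ τ : ℝ, |τ| < ε₀ →
      IsFrame fun k : ι → ℤ => e ((1 + τ) • intVec k) := by
  obtain ⟨A, B, hA, hB, hF⟩ := isFrame_iff_hasFrameBounds.1 hframe
  obtain ⟨K, hK⟩ := hF.exists_expansion hA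
  obtain ⟨N, hN0, hN⟩ := exists_tsum_near_le ι (zero_le_two (α := ℝ))
  obtain ⟨B', hB'⟩ := exists_bessel_bound hs hC he
  -- Combining `hlower` and `hupper` below yields `A²/4 ‖f‖² ≤ 2η(10B + A)K ‖f‖² + 16BN Y`. This `η`
  -- makes the error at most `A²/8 ‖f‖²`, which leaves the lower frame bound `A²/(128BN)`.
  set η : ℝ≥0 := A ^ 2 / (16 * ((10 * B + A) * K + 1)) with hη
  have hη0 : 0 < η := by positivity
  have hηK : η * ((10 * B + A) * K) ≤ A ^ 2 / 16 := by
    rw [hη, div_mul_eq_mul_div, div_le_div_iff₀ (by positivity) (by positivity)]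
    calc A ^ 2 * ((10 * B + A) * K) * 16 ≤ A ^ 2 * ((10 * B + A) * K + 1) * 16 := by
          gcongr; exact le_self_add
      _ = _ := by ring
  obtain ⟨T₀, hT₀1, hT₀⟩ := exists_localError_le hs hC he hη0
  -- The factor `2` guarantees `(1 + τ)R ≥ T₀` whenever `τ ≥ -1/2`. The scale is thus fixed before
  -- `δ`, `r` and the range of `τ`.
  set R : ℕ := ⌈2 * T₀⌉₊
  have hR : 2 * T₀ ≤ R := Nat.le_ceil _
  obtain ⟨N', hN'0, hN'⟩ := exists_tsum_near_le ι (show (0 : ℝ) ≤ 2 * R by positivity)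
  set δ : ℝ≥0 := NNReal.sqrt (A / (4 * N'))
  have hδ0 : 0 < δ := NNReal.sqrt_pos.2 (by positivity)
  have hNδ : 2 * N' * δ ^ 2 ≤ A / 2 := by
    rw [NNReal.sq_sqrt]
    apply le_of_eq
    field_simp
    norm_num
  obtain ⟨r, hr0, hr⟩ := Metric.continuousAt_iff.1 hcont δ hδ0
  refine ⟨min (1 / 2) (r / (2 * R + 1)), by positivity, fun τ hτ => ?_⟩
  have hτ1 := abs_lt.1 (hτ.trans_le (min_le_left _ _))
  have hτ2 := hτ.trans_le (min_le_right _ _)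
  have hθ : 1 / 2 ≤ 1 + τ := by linarith
  set T : ℝ := (1 + τ) * R with hT
  have hTT₀ : T₀ ≤ T := by nlinarith
  have hTR : T ≤ 2 * R := by
    have : (0 : ℝ) ≤ R := by positivity
    nlinarith
  have hτr : |τ| * (2 * R) < r := by
    rw [lt_div_iff₀ (by positivity)] at hτ2
    linarith [abs_nonneg τ]
  refine isFrame_iff_hasFrameBounds.2
    ⟨A ^ 2 / (128 * B * N), B' * K + 1, by positivity, by positivity, fun f => ?_⟩
  obtain ⟨c, hc, hcf⟩ := hK f
  set X := ∑' j, ‖localPart e c T j‖ₑ ^ 2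
  set Y := ∑' m : ι → ℤ, ‖inner ℂ (e ((1 + τ) • intVec m)) f‖ₑ ^ 2
  have hY : Y ≤ B' * (K * ‖f‖ₑ ^ 2) := (hB' _ hθ c f hcf).trans (by gcongr)
  have herr : ∀ θ : ℝ, 1 / 2 ≤ θ → ∀ w : (ι → ℤ) → ι → ℝ, (∀ j, ‖w j‖ ≤ 1) →
      ∑' j, ∑' m, ‖localError e c f T j (θ • intVec m + w j)‖ₑ ^ 2 ≤ η * (K * ‖f‖ₑ ^ 2) :=
    fun θ hθ w hw => (hT₀ T hTT₀ θ hθ w hw c f hcf).trans (by gcongr)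
  have hlower : ((A / 4 : ℝ≥0) : ℝ≥0∞) * ‖f‖ₑ ^ 2 ≤ 2 * B * X + 2 * (η * (K * ‖f‖ₑ ^ 2)) := by
    refine hF.le_tsum_localPart c f ?_
    simpa using herr 1 (by norm_num) (fun _ => 0) (by simp)
  have herr1 : ∑' j, ∑' m, ‖localError e c f T j ((1 + τ) • intVec m)‖ₑ ^ 2 ≤
      η * (K * ‖f‖ₑ ^ 2) := by
    simpa using herr (1 + τ) hθ (fun _ => 0) (by simp)
  have herr2 : ∑' j, ∑' m, ‖localError e c f T j (intVec m + (τ * R) • intVec j)‖ₑ ^ 2 ≤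
      η * (K * ‖f‖ₑ ^ 2) := by
    -- The shifts `τ R j` are unbounded, but the translated lattice depends on them only modulo
    -- integer vectors, so they can be reduced to norm at most `1`.
    choose p hp using fun j : ι → ℤ => exists_norm_sub_intVec_le_one ((τ * R) • intVec j)
    refine le_of_eq_of_le (tsum_congr fun j => ?_)
      (herr 1 (by norm_num) (fun j => (τ * R) • intVec j - intVec (p j)) hp)
    conv_rhs => rw [← (Equiv.addRight (p j)).tsum_eq]
    refine tsum_congr fun m => ?_
    rw [Equiv.coe_addRight, intVec_add, one_smul]
    congr 3
    abel
  have hnear : ∑' j, ∑' m, ENNReal.ofReal (tent T j ((1 + τ) • intVec m) ^ 2) *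
      ‖inner ℂ (e ((1 + τ) • intVec m)) f‖ₑ ^ 2 ≤ N * Y := by
    rw [ENNReal.tsum_comm, ← ENNReal.tsum_mul_left]
    refine ENNReal.tsum_le_tsum fun m => ?_
    rw [ENNReal.tsum_mul_right]
    gcongr
    exact (ENNReal.tsum_le_tsum fun j => ofReal_tent_sq_le _ _ _).trans (hN _)
  have hupper : ((A / 2 : ℝ≥0) : ℝ≥0∞) * X ≤ 5 * (η * (K * ‖f‖ₑ ^ 2)) + 4 * (N * Y) := by
    have h1 := ENNReal.tsum_le_tsum fun j => hcov.lower_bound_localPart hF (δ := δ)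
      (by linarith) hT hTR hτr (fun u hu => by
        rw [← dist_eq_norm]; exact (hr (by simpa using hu)).le) hN' hNδ c f j
    rw [ENNReal.tsum_mul_left, ENNReal.tsum_add, ENNReal.tsum_add, ENNReal.tsum_mul_left,
      ENNReal.tsum_mul_left] at h1
    refine h1.trans ?_
    calc _ ≤ η * (K * ‖f‖ₑ ^ 2) + 4 * (η * (K * ‖f‖ₑ ^ 2)) + 4 * (N * Y) := by gcongr
      _ = _ := by ring
  have hYtop : Y ≠ ∞ := (hY.trans_lt (by finiteness)).ne
  -- Finiteness allows the error terms to be absorbed by real arithmetic.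
  have hXtop : X ≠ ∞ := by
    intro hX
    rw [hX, ENNReal.mul_top (by simpa using hA.ne')] at hupper
    exact absurd hupper (not_le.2 (by finiteness))
  refine ⟨?_, hY.trans ?_⟩
  · clear_value X Y
    lift X to ℝ≥0 using hXtop
    lift Y to ℝ≥0 using hYtop
    have hf : ‖f‖ₑ ^ 2 = ((‖f‖₊ ^ 2 : ℝ≥0) : ℝ≥0∞) := by rw [ENNReal.coe_pow]; rfl
    rw [hf] at hlower hupper ⊢
    norm_cast at hlower hupper ⊢
    set F := ‖f‖₊ ^ 2
    clear_value F η
    rw [div_mul_eq_mul_div, div_le_iff₀ (by positivity)]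
    have h1 : (A : ℝ) / 4 * F ≤ 2 * B * X + 2 * (η * (K * F)) := by exact_mod_cast hlower
    have h2 : (A : ℝ) / 2 * X ≤ 5 * (η * (K * F)) + 4 * (N * Y) := by exact_mod_cast hupper
    have h3 : (η : ℝ) * ((10 * B + A) * K) ≤ A ^ 2 / 16 := by exact_mod_cast hηK
    have h4 : (A : ℝ) ^ 2 * F ≤ Y * (128 * B * N) := by
      have e1 := mul_le_mul_of_nonneg_left h1 A.coe_nonneg
      have e2 := mul_le_mul_of_nonneg_left h2 B.coe_nonneg
      have e3 := mul_le_mul_of_nonneg_right h3 F.coe_nonneg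
      linarith
    exact_mod_cast h4
  · rw [← mul_assoc]
    push_cast
    gcongr
    exact le_self_add

end Dilation

/-! ### Time-frequency shifts -/

section TimeFrequency

variable {d : ℕ}

/-- The character `t ↦ e^{2πi ξ·t}`. -/
def modulation (ξ t : Rd d) : ℂ :=
  Complex.exp (2 * Real.pi * Complex.I * (inner ℝ ξ t : ℝ))

theorem norm_modulation (ξ t : Rd d) : ‖modulation ξ t‖ = 1 := by
  rw [modulation, Complex.norm_exp]
  simp

theorem modulation_add_left (ξ η t : Rd d) :
    modulation (ξ + η) t = modulation ξ t * modulation η t := by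
  rw [modulation, modulation, modulation, ← Complex.exp_add, inner_add_left]
  push_cast
  ring_nf

theorem modulation_add_right (ξ t u : Rd d) :
    modulation ξ (t + u) = modulation ξ t * modulation ξ u := by
  rw [modulation, modulation, modulation, ← Complex.exp_add, inner_add_right]
  push_cast
  ring_nf

theorem modulation_neg_left (ξ t : Rd d) : modulation (-ξ) t = conj (modulation ξ t) := by
  rw [modulation, modulation, ← Complex.exp_conj, inner_neg_left]
  simp [map_ofNat]

theorem modulation_zero_left (t : Rd d) : modulation 0 t = 1 := by
  simp [modulation]

theorem tfShiftFun_apply (z : Phase d) (f : Rd d → ℂ) (t : Rd d) :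
    tfShiftFun z f t = modulation (freqPart z) t * f (t - timePart z) := rfl

theorem coeFn_tfShift (z : Phase d) (f : L2 d) : tfShift z f =ᵐ[volume] tfShiftFun z f :=
  MemLp.coeFn_toLp _

theorem timePart_add (z w : Phase d) : timePart (z + w) = timePart z + timePart w := rfl

theorem freqPart_add (z w : Phase d) : freqPart (z + w) = freqPart z + freqPart w := rfl

theorem timePart_neg (z : Phase d) : timePart (-z) = -timePart z := rfl

theorem freqPart_neg (z : Phase d) : freqPart (-z) = -freqPart z := rfl

theorem timePart_zero : timePart (0 : Phase d) = 0 := rfl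

theorem freqPart_zero : freqPart (0 : Phase d) = 0 := rfl

theorem tfShift_zero (f : L2 d) : tfShift 0 f = f := by
  refine Lp.ext ((coeFn_tfShift 0 f).trans (Filter.Eventually.of_forall fun t => ?_))
  rw [tfShiftFun_apply, freqPart_zero, timePart_zero, modulation_zero_left, one_mul, sub_zero]

theorem norm_tfShift (z : Phase d) (f : L2 d) : ‖tfShift z f‖ = ‖f‖ := by
  rw [tfShift, Lp.norm_toLp, Lp.norm_def]
  congr 1
  calc eLpNorm (tfShiftFun z f) 2 volume
      = eLpNorm (fun t => f (t - timePart z)) 2 volume :=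
        eLpNorm_congr_norm_ae (Filter.Eventually.of_forall fun t => by
          rw [tfShiftFun_apply, norm_mul, norm_modulation, one_mul])
    _ = eLpNorm f 2 volume :=
        eLpNorm_comp_measurePreserving (Lp.aestronglyMeasurable f)
          (measurePreserving_sub_right volume (timePart z))

theorem inner_tfShift_left (z : Phase d) (g f : L2 d) :
    inner ℂ (tfShift z g) f = ∫ t, f t * conj (tfShiftFun z g t) := by
  rw [L2.inner_def]
  refine integral_congr_ae ?_
  filter_upwards [coeFn_tfShift z g] with t ht
  rw [RCLike.inner_apply, ht]

theorem stft_eq_inner (g f : L2 d) (z : Phase d) : stft g f z = inner ℂ (tfShift z g) f := by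
  rw [inner_tfShift_left, stft]
  congr 1
  ext t
  rw [tfShiftFun_apply, map_mul, modulation, ← Complex.exp_conj]
  simp only [map_mul, Complex.conj_I, Complex.conj_ofReal, map_ofNat]
  ring_nf

/-- Covariance of coefficients with respect to time-frequency shifts. -/
theorem norm_inner_tfShift_add (z w : Phase d) (g f : L2 d) :
    ‖inner ℂ (tfShift (z + w) g) f‖ = ‖inner ℂ (tfShift z g) (tfShift (-w) f)‖ := by
  have h : inner ℂ (tfShift (z + w) g) f =
      conj (modulation (freqPart z + freqPart w) (timePart w)) *
        inner ℂ (tfShift z g) (tfShift (-w) f) := by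
    -- Substituting `t + timePart w` for `t` leaves a phase independent of `t`.
    rw [inner_tfShift_left, inner_tfShift_left,
      ← integral_add_right_eq_self _ (timePart w), ← integral_const_mul]
    refine integral_congr_ae ?_
    filter_upwards [coeFn_tfShift (-w) f] with t ht
    rw [ht, tfShiftFun_apply, tfShiftFun_apply, tfShiftFun_apply, timePart_add, freqPart_add,
      timePart_neg, freqPart_neg, modulation_add_right, modulation_add_left _ _ t,
      modulation_neg_left, sub_neg_eq_add, show t + timePart w - (timePart z + timePart w) =
        t - timePart z by abel]
    simp only [map_mul]
    ring
  rw [h, norm_mul, RCLike.norm_conj, norm_modulation, one_mul]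

theorem norm_inner_tfShift_tfShift (z w : Phase d) (g : L2 d) :
    ‖inner ℂ (tfShift z g) (tfShift w g)‖ = ‖stft g g (z - w)‖ := by
  rw [stft_eq_inner, sub_eq_add_neg, norm_inner_tfShift_add, neg_neg]

/-! ### Norm continuity of the shifts at the origin -/

theorem continuous_timePart : Continuous (timePart : Phase d → Rd d) := by
  unfold timePart; fun_prop

theorem continuous_freqPart : Continuous (freqPart : Phase d → Rd d) := by
  unfold freqPart; fun_prop

/-- Translation of square-integrable functions. -/
def translate (x : Rd d) (g : L2 d) : L2 d :=
  Lp.compMeasurePreserving (fun t => t - x) (measurePreserving_sub_right volume x) g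

theorem continuous_translate (g : L2 d) : Continuous fun x => translate x g := by
  let G : Rd d → C(Rd d, Rd d) :=
    (ContinuousMap.mk (fun a : Rd d × Rd d => a.2 - a.1) (by fun_prop)).curry
  exact continuous_const.compMeasurePreservingLp (g := G) (ContinuousMap.continuous _)
    (fun x => measurePreserving_sub_right volume x) (by norm_num)

theorem translate_zero (g : L2 d) : translate 0 g = g := by
  refine Lp.ext ((Lp.coeFn_compMeasurePreserving g _).trans ?_)
  refine Filter.Eventually.of_forall fun t => ?_
  simp

/-- Insert the purely modulated vector between `tfShift z g` and `g`. The modulation is unimodular,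
so the first difference has the norm of a pure translation difference. -/
theorem norm_sub_le_modulation_add_translate (z : Phase d) (g : L2 d) :
    ‖tfShift z g - g‖ ≤ ‖translate (timePart z) g - g‖ +
      Real.sqrt (∫ t, ‖modulation (freqPart z) t - 1‖ ^ 2 * ‖g t‖ ^ 2) := by
  set m : L2 d := tfShift (WithLp.toLp 2 (Sum.elim 0 (freqPart z))) g with hm
  have hmf : m =ᵐ[volume] fun t => modulation (freqPart z) t * g t := by
    refine (coeFn_tfShift _ g).trans (Filter.Eventually.of_forall fun t => ?_)
    rw [tfShiftFun_apply]
    have h1 : timePart (WithLp.toLp 2 (Sum.elim 0 (freqPart z)) : Phase d) = 0 := rfl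
    have h2 : freqPart (WithLp.toLp 2 (Sum.elim 0 (freqPart z)) : Phase d) = freqPart z := rfl
    rw [h1, h2, sub_zero]
  refine (norm_sub_le_norm_sub_add_norm_sub _ m _).trans (add_le_add ?_ ?_)
  · refine Lp.norm_le_norm_of_ae_le ?_
    filter_upwards [Lp.coeFn_sub (tfShift z g) m, Lp.coeFn_sub (translate (timePart z) g) g,
      coeFn_tfShift z g, hmf,
      Lp.coeFn_compMeasurePreserving g (measurePreserving_sub_right volume (timePart z))]
      with t h1 h2 h3 h4 h5
    rw [h1, h2, Pi.sub_apply, Pi.sub_apply, h3, h4, tfShiftFun_apply, translate, h5, ← mul_sub,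
      norm_mul, norm_modulation, one_mul]
    rfl
  · refine Real.le_sqrt_of_sq_le (le_of_eq ?_)
    rw [← inner_self_eq_norm_sq (𝕜 := ℂ), L2.inner_def, ← integral_re]
    · refine integral_congr_ae ?_
      filter_upwards [Lp.coeFn_sub m g, hmf] with t h1 h2
      rw [inner_self_eq_norm_sq, h1, Pi.sub_apply, h2, ← sub_one_mul, norm_mul, mul_pow]
    · exact L2.integrable_inner _ _

theorem continuous_integral_modulation (g : L2 d) :
    Continuous fun ξ : Rd d => ∫ t, ‖modulation ξ t - 1‖ ^ 2 * ‖g t‖ ^ 2 := by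
  have hg : Integrable (fun t => ‖g t‖ ^ 2) volume := (Lp.memLp g).integrable_norm_pow two_ne_zero
  refine continuous_of_dominated (bound := fun t => 4 * ‖g t‖ ^ 2) (fun ξ => ?_) (fun ξ => ?_)
    (hg.const_mul 4) ?_
  · refine AEStronglyMeasurable.mul (Continuous.aestronglyMeasurable ?_) hg.aestronglyMeasurable
    unfold modulation
    fun_prop
  · refine Filter.Eventually.of_forall fun t => ?_
    rw [Real.norm_of_nonneg (by positivity)]
    have h1 : ‖modulation ξ t - 1‖ ≤ 2 := by
      refine (norm_sub_le _ _).trans ?_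
      rw [norm_modulation, norm_one]
      norm_num
    gcongr
    nlinarith [norm_nonneg (modulation ξ t - 1)]
  · refine Filter.Eventually.of_forall fun t => ?_
    unfold modulation
    fun_prop

theorem continuousAt_tfShift_zero (g : L2 d) : ContinuousAt (fun z => tfShift z g) 0 := by
  rw [ContinuousAt, tfShift_zero, tendsto_iff_norm_sub_tendsto_zero]
  refine squeeze_zero (fun _ => norm_nonneg _)
    (fun z => norm_sub_le_modulation_add_translate z g) ?_
  have h : Continuous fun z : Phase d => ‖translate (timePart z) g - g‖ +
      Real.sqrt (∫ t, ‖modulation (freqPart z) t - 1‖ ^ 2 * ‖g t‖ ^ 2) :=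
    (((continuous_translate g).comp continuous_timePart).sub continuous_const).norm.add
      ((continuous_integral_modulation g).comp continuous_freqPart).sqrt
  have h0 := h.tendsto 0
  simpa only [timePart_zero, freqPart_zero, translate_zero, modulation_zero_left, sub_self,
    norm_zero, ne_eq, OfNat.ofNat_ne_zero, not_false_eq_true, zero_pow, zero_mul, integral_zero,
    Real.sqrt_zero, add_zero] using h0

/-! ### Lattice coordinates -/

/-- The parametrization of phase space by coordinates with respect to the columns of a matrix. -/
def latticeMap (M : Matrix (Fin d ⊕ Fin d) (Fin d ⊕ Fin d) ℝ) :
    (Fin d ⊕ Fin d → ℝ) →ₗ[ℝ] Phase d :=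
  (WithLp.linearEquiv 2 ℝ (Fin d ⊕ Fin d → ℝ)).symm.toLinearMap ∘ₗ M.mulVecLin

/-- Transfers decay in phase space to coordinates; `1 ≤ q` lets the weight `1 + ‖y‖` be compared as
well. -/
theorem exists_norm_le_latticeMap {M : Matrix (Fin d ⊕ Fin d) (Fin d ⊕ Fin d) ℝ} (hM : M.det ≠ 0) :
    ∃ q : ℝ, 1 ≤ q ∧ ∀ y, ‖y‖ ≤ q * ‖latticeMap M y‖ := by
  let Ψ : Phase d →L[ℝ] (Fin d ⊕ Fin d → ℝ) := LinearMap.toContinuousLinearMap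
    (M⁻¹.mulVecLin ∘ₗ (WithLp.linearEquiv 2 ℝ (Fin d ⊕ Fin d → ℝ)).toLinearMap)
  have hΨ : ∀ y, Ψ (latticeMap M y) = y := fun y => by
    change M⁻¹.mulVec (M.mulVec y) = y
    rw [Matrix.mulVec_mulVec, Matrix.nonsing_inv_mul _ (isUnit_iff_ne_zero.2 hM),
      Matrix.one_mulVec]
  refine ⟨max 1 ‖Ψ‖, le_max_left _ _, fun y => ?_⟩
  calc ‖y‖ = ‖Ψ (latticeMap M y)‖ := by rw [hΨ]
    _ ≤ ‖Ψ‖ * ‖latticeMap M y‖ := Ψ.le_opNorm _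
    _ ≤ _ := by gcongr; exact le_max_right _ _

theorem isFrame_gaborSystem_range {κ : Type*} {u : κ → Phase d} (hu : Function.Injective u)
    (g : L2 d) : IsFrame (gaborSystem g (Set.range u)) ↔ IsFrame fun k => tfShift (u k) g := by
  have h : ∀ f : L2 d, (Summable (fun i => ‖inner ℂ (gaborSystem g (Set.range u) i) f‖ ^ 2) ↔
      Summable fun k => ‖inner ℂ (tfShift (u k) g) f‖ ^ 2) ∧
      ∑' i, ‖inner ℂ (gaborSystem g (Set.range u) i) f‖ ^ 2 =
        ∑' k, ‖inner ℂ (tfShift (u k) g) f‖ ^ 2 := fun f =>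
    ⟨((Equiv.ofInjective u hu).summable_iff
      (f := fun i => ‖inner ℂ (gaborSystem g (Set.range u) i) f‖ ^ 2)).symm,
    ((Equiv.ofInjective u hu).tsum_eq
      fun i => ‖inner ℂ (gaborSystem g (Set.range u) i) f‖ ^ 2).symm⟩
  unfold IsFrame
  simp only [fun f => (h f).1, fun f => (h f).2]

end TimeFrequency

end Gabor

end

/-! ### Application to Gabor systems -/

theorem theoremt (d : ℕ) (s : ℝ) (hs : 2 * (d : ℝ) < s) (g : Gabor.L2 d)
    (hg : Gabor.MemModulation s g) (Λ : Set (Gabor.Phase d)) (hΛ : Gabor.IsLattice Λ)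
    (hframe : Gabor.IsFrame (Gabor.gaborSystem g Λ)) :
    ∃ ε₀ : ℝ, 0 < ε₀ ∧ ∀ τ : ℝ, |τ| < ε₀ →
      Gabor.IsFrame (Gabor.gaborSystem g ((1 + τ) • Λ)) := by
  obtain ⟨C, hC⟩ := hg
  obtain ⟨M, hM, rfl⟩ := hΛ
  obtain ⟨q, hq1, hq⟩ := Gabor.exists_norm_le_latticeMap hM
  have hinj : Function.Injective (Gabor.latticeMap M) :=
    (injective_iff_map_eq_zero _).2 fun y hy => norm_le_zero_iff.1 (by simpa [hy] using hq y)
  have hs0 : 0 ≤ s := by linarith [(Nat.cast_nonneg d : (0 : ℝ) ≤ d)]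
  have hscale : ∀ a : ℝ, a ≠ 0 → Function.Injective fun k : Fin d ⊕ Fin d → ℤ =>
      Gabor.latticeMap M (a • Gabor.intVec k) := fun a ha k l h =>
    Gabor.intVec_injective (smul_right_injective _ ha (hinj h))
  have hframe' : Gabor.IsFrame fun k : Fin d ⊕ Fin d → ℤ =>
      Gabor.tfShift (Gabor.latticeMap M (Gabor.intVec k)) g :=
    (Gabor.isFrame_gaborSystem_range (hinj.comp Gabor.intVec_injective) g).1 hframe
  -- The given `C` carries no sign, hence `|C|`; the factor `q ^ s` is the cost of measuring decay
  -- in coordinates. The index set has `2d` elements, so `s > 2d` is the required decay.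
  obtain ⟨ε, hε, h⟩ := Gabor.exists_isFrame_dilation (s := s) (C := |C| * q ^ s)
    (e := fun y => Gabor.tfShift (Gabor.latticeMap M y) g)
    (by simpa [two_mul] using hs) (by positivity)
    (fun x y => by
      rw [Gabor.norm_inner_tfShift_tfShift, ← map_sub]
      refine (hC _).trans ?_
      rw [mul_assoc]
      refine mul_le_mul (le_abs_self C) ?_ (by positivity) (abs_nonneg _)
      refine Gabor.one_add_norm_rpow_le hs0 (norm_nonneg _) (norm_nonneg _) (by linarith) ?_
      linarith [hq (x - y)])
    (fun w f => ⟨Gabor.tfShift (-Gabor.latticeMap M w) f, Gabor.norm_tfShift _ _, fun y => by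
      simp only [map_add]
      exact Gabor.norm_inner_tfShift_add _ _ _ _⟩)
    (ContinuousAt.comp (g := fun z => Gabor.tfShift z g)
      (by rw [map_zero]; exact Gabor.continuousAt_tfShift_zero g)
      (LinearMap.continuous_of_finiteDimensional (Gabor.latticeMap M)).continuousAt)
    hframe'
  -- The bound `1/2` keeps `1 + τ` nonzero, so that distinct integer vectors still index distinct
  -- points.
  refine ⟨min ε (1 / 2), by positivity, fun τ hτ => ?_⟩
  have hτ1 := (abs_lt.1 (hτ.trans_le (min_le_right _ _))).1
  have hrange : ((1 + τ) • Set.range fun k : Fin d ⊕ Fin d → ℤ =>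
        (WithLp.toLp 2 (M.mulVec fun i => (k i : ℝ)) : Gabor.Phase d)) =
      Set.range fun k : Fin d ⊕ Fin d → ℤ => Gabor.latticeMap M ((1 + τ) • Gabor.intVec k) := by
    rw [← Set.image_smul, ← Set.range_comp]
    congr 1
    ext1 k
    rw [map_smul]
    rfl
  rw [hrange, Gabor.isFrame_gaborSystem_range (hscale _ (by linarith))]
  exact h τ (hτ.trans_le (min_le_left _ _))
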